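/- **Theorem.** In weighted paging there are $n$ pages with positive weights, known to the algorithm, and a cache holding at most $k$ pages, where $1\le k<n$. The cache is initially empty, each requested page must be in the cache directly after its request, and the cost is the total weight of all evicted pages. An online algorithm has $\ell$-strong lookahead if at each request it sees, besides the past requests and the current one, all following requests up to and including the $\ell$-th distinct page among them (all remaining requests, if they contain fewer than $\ell$ distinct pages). An algorithm is $c$-competitive if for all positive weights there is a constant $b$ such that on every finite request sequence $\sigma$ its (expected, if it is randomized) cost is at most $c\cdot\mathrm{OPT}(\sigma)+b$, where $\mathrm{OPT}(\sigma)$ is the optimal offline cost; request sequences do not depend on the random choices of the algorithm. There is an absolute constant $C>0$ such that the following holds for all integers $1\le k<n$ and $\ell\ge 0$. 1. If $\ell\le n-k$, then every $c$-competitive deterministic algorithm with $\ell$-strong lookahead has $c\ge C\,k$, and every $c$-competitive randomized algorithm with $\ell$-strong lookahead has $c\ge C\log k$. 2. If $n-k+1\le\ell\le n-1$, then every $c$-competitive deterministic algorithm with $\ell$-strong lookahead has $c\ge C\,(n-\ell)$, and every $c$-competitive randomized algorithm with $\ell$-strong lookahead has $c\ge C\log(n-\ell)$. -/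

import Mathlib

universe u

namespace WeightedPaging

/-- The shortest prefix of a request sequence that, together with the pages in `seen`, contains `ℓ`
distinct pages; the whole sequence if there is no such prefix. -/
def lookaheadAux {n : ℕ} (ℓ : ℕ) : Finset (Fin n) → List (Fin n) → List (Fin n)
  | _, [] => []
  | seen, p :: s => if seen.card < ℓ then p :: lookaheadAux ℓ (insert p seen) s else []

/-- The `ℓ`-strong lookahead into the sequence `s` of requests after the current one: all requests
up to and including the `ℓ`-th distinct page (all of `s` if it has fewer distinct pages). -/
def lookahead {n : ℕ} (ℓ : ℕ) (s : List (Fin n)) : List (Fin n) :=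
  lookaheadAux ℓ ∅ s

/-- A schedule lists the cache contents directly after each request. It is feasible for the request
sequence `σ` and cache size `k` if each cache has at most `k` pages, among them the page that has
just been requested. -/
def IsSchedule {n : ℕ} (k : ℕ) (σ : List (Fin n)) (Cs : List (Finset (Fin n))) : Prop :=
  List.Forall₂ (fun p C => p ∈ C ∧ C.card ≤ k) σ Cs

/-- The total weight of all evicted pages, when the cache contents are `C` at first and then run
through the given list. -/
def scheduleCost {n : ℕ} (w : Fin n → ℝ) : Finset (Fin n) → List (Finset (Fin n)) → ℝ
  | _, [] => 0
  | C, C' :: Cs => (∑ p ∈ C \ C', w p) + scheduleCost w C' Cs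

/-- The optimal offline cost of `σ` with cache size `k`, starting with an empty cache. -/
noncomputable def opt {n : ℕ} (k : ℕ) (w : Fin n → ℝ) (σ : List (Fin n)) : ℝ :=
  sInf {x | ∃ Cs, IsSchedule k σ Cs ∧ x = scheduleCost w ∅ Cs}

/-- A deterministic online algorithm for weighted paging with pages `Fin n` and cache size `k`,
given lookahead. It knows the page weights. `next w past p look` is the cache content directly after
the request `p`, when `past` is the list of all earlier requests (oldest first) and `look` is the
lookahead that is visible at this time. -/
structure DetAlg (n k : ℕ) where
  next : (Fin n → ℝ) → List (Fin n) → Fin n → List (Fin n) → Finset (Fin n)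
  mem_next : ∀ w past p look, p ∈ next w past p look
  card_next : ∀ w past p look, (next w past p look).card ≤ k

/-- The caches of the algorithm `A` with `ℓ`-strong lookahead on the remaining requests, after the
requests in the first list have been served. -/
def DetAlg.runFrom {n k : ℕ} (A : DetAlg n k) (ℓ : ℕ) (w : Fin n → ℝ) :
    List (Fin n) → List (Fin n) → List (Finset (Fin n))
  | _, [] => []
  | past, p :: s => A.next w past p (lookahead ℓ s) :: A.runFrom ℓ w (past ++ [p]) s

/-- The cost of `A` with `ℓ`-strong lookahead on the request sequence `σ`, starting with an empty
cache. -/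
def DetAlg.cost {n k : ℕ} (A : DetAlg n k) (ℓ : ℕ) (w : Fin n → ℝ) (σ : List (Fin n)) : ℝ :=
  scheduleCost w ∅ (A.runFrom ℓ w [] σ)

/-- `A` with `ℓ`-strong lookahead is `c`-competitive: for all positive weights its cost is at most
`c` times the optimum, up to an additive constant that does not depend on the requests. -/
def DetAlg.IsCompetitive {n k : ℕ} (A : DetAlg n k) (ℓ : ℕ) (c : ℝ) : Prop :=
  ∀ w : Fin n → ℝ, (∀ p, 0 < w p) →
    ∃ b : ℝ, ∀ σ : List (Fin n), A.cost ℓ w σ ≤ c * opt k w σ + b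

/-- A randomized online algorithm: a random deterministic one, drawn from a probability space. -/
structure RandAlg (n k : ℕ) where
  Ω : Type u
  [measurableSpace : MeasurableSpace Ω]
  μ : MeasureTheory.Measure Ω
  [isProbabilityMeasure : MeasureTheory.IsProbabilityMeasure μ]
  alg : Ω → DetAlg n k
  measurableSet_next : ∀ w past p look (C : Finset (Fin n)),
    MeasurableSet {ω | (alg ω).next w past p look = C}

attribute [instance] RandAlg.measurableSpace RandAlg.isProbabilityMeasure

/-- The expected cost of a randomized algorithm on a fixed request sequence. -/
noncomputable def RandAlg.expectedCost {n k : ℕ} (A : RandAlg.{u} n k) (ℓ : ℕ) (w : Fin n → ℝ)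
    (σ : List (Fin n)) : ℝ :=
  ∫ ω, (A.alg ω).cost ℓ w σ ∂A.μ

/-- A randomized algorithm with `ℓ`-strong lookahead is `c`-competitive (against request sequences
that are fixed in advance). -/
def RandAlg.IsCompetitive {n k : ℕ} (A : RandAlg.{u} n k) (ℓ : ℕ) (c : ℝ) : Prop :=
  ∀ w : Fin n → ℝ, (∀ p, 0 < w p) →
    ∃ b : ℝ, ∀ σ : List (Fin n), A.expectedCost ℓ w σ ≤ c * opt k w σ + b

end WeightedPaging

namespace WeightedPaging

open Finset

variable {n k : ℕ}

/-! ### Lookahead -/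

/-! Both parts follow from one adversary, with `s = k` or `s = n - ℓ`. Fix `S ⊆ E` of sizes `s` and
`k`, and `a ∉ E`. Pages in `E` weigh 1, the others a tiny `ε`. Each block requests `a`, then all `n
- s ≥ ℓ` pages outside `S`, then a page `p ∈ S` that is still invisible when `a` is served. The
cache then contains `a`, so it lacks a page of `E`: either one outside `S`, which is about to be
requested, or one that can be chosen as `p` (`exists_missing_eq_one`, `gain_le_cost`). Offline, it
suffices to keep `E` minus the page of `S` that is requested last in the current phase and to pass
all other requests through the free slot. This costs about 1 per phase (`opt_requests_le`), and a
phase has at least `s` blocks, which gives ratio `s`. Against randomization, some `p` is missed with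
probability at least the average `1/s`; coupon collecting then gives the harmonic number `H_s`. A
potential in the number of pages still unseen in the phase handles both cases (`exists_le_gain`). -/

lemma lookaheadAux_append {ℓ : ℕ} (s t : List (Fin n)) (seen : Finset (Fin n))
    (h : ℓ ≤ (seen ∪ s.toFinset).card) :
    lookaheadAux ℓ seen (s ++ t) = lookaheadAux ℓ seen s := by
  induction s generalizing seen with
  | nil =>
    have h' : ¬ seen.card < ℓ := by simpa using h
    cases t <;> simp [lookaheadAux, h']
  | cons p s ih =>
    have h' : ℓ ≤ (insert p seen ∪ s.toFinset).card := by
      simpa [Finset.insert_union, Finset.union_insert] using h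
    simp only [List.cons_append, lookaheadAux, ih _ h']

lemma lookahead_append {ℓ : ℕ} (s t : List (Fin n)) (h : ℓ ≤ s.toFinset.card) :
    lookahead ℓ (s ++ t) = lookahead ℓ s :=
  lookaheadAux_append s t ∅ (by simpa using h)

/-! ### Costs of schedules -/

lemma scheduleCost_nonneg {w : Fin n → ℝ} (hw : ∀ p, 0 < w p) (C : Finset (Fin n))
    (Cs : List (Finset (Fin n))) : 0 ≤ scheduleCost w C Cs := by
  induction Cs generalizing C with
  | nil => exact le_rfl
  | cons C' Cs ih => exact add_nonneg (sum_nonneg fun p _ => (hw p).le) (ih C')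

lemma opt_nonneg {w : Fin n → ℝ} (hw : ∀ p, 0 < w p) (σ : List (Fin n)) : 0 ≤ opt k w σ := by
  refine Real.sInf_nonneg ?_
  rintro _ ⟨Cs, -, rfl⟩
  exact scheduleCost_nonneg hw _ _

lemma opt_le {w : Fin n → ℝ} (hw : ∀ p, 0 < w p) {σ : List (Fin n)}
    {Cs : List (Finset (Fin n))} (h : IsSchedule k σ Cs) : opt k w σ ≤ scheduleCost w ∅ Cs := by
  refine csInf_le ⟨0, ?_⟩ ⟨Cs, h, rfl⟩
  rintro _ ⟨Cs, -, rfl⟩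
  exact scheduleCost_nonneg hw _ _

/-- The total weight of all pages loaded into the cache by a schedule. -/
def loadCost (w : Fin n → ℝ) : Finset (Fin n) → List (Finset (Fin n)) → ℝ
  | _, [] => 0
  | C, C' :: Cs => (∑ p ∈ C' \ C, w p) + loadCost w C' Cs

/-- Loads minus evictions telescope to the change in cache weight. Lower bounds may thus count
loads, which requests force directly. -/
lemma loadCost_le {w : Fin n → ℝ} (hw : ∀ p, 0 < w p) (C : Finset (Fin n))
    (Cs : List (Finset (Fin n))) :
    loadCost w C Cs ≤ scheduleCost w C Cs + ∑ p, w p - ∑ p ∈ C, w p := by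
  induction Cs generalizing C with
  | nil =>
    have := sum_le_sum_of_subset_of_nonneg (subset_univ C) (fun p _ _ => (hw p).le)
    simp only [loadCost, scheduleCost]
    linarith
  | cons C' Cs ih =>
    have h1 := ih C'
    have h2 := sum_sdiff_sub_sum_sdiff (s₁ := C) (s₂ := C') (f := w)
    simp only [loadCost, scheduleCost]
    linarith

section Run

variable (A : DetAlg n k) (ℓ : ℕ) {w : Fin n → ℝ} (hw : ∀ p, 0 < w p)
include hw

lemma le_loadCost_runFrom_append {B : ℝ} (s t past : List (Fin n)) (C : Finset (Fin n))
    (hB : ∀ C, B ≤ loadCost w C (A.runFrom ℓ w (past ++ s) t)) :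
    B ≤ loadCost w C (A.runFrom ℓ w past (s ++ t)) := by
  induction s generalizing past C with
  | nil => simpa using hB C
  | cons x s ih =>
    exact le_add_of_nonneg_of_le (sum_nonneg fun p _ => (hw p).le)
      (ih (past ++ [x]) _ (by simpa using hB))

/-- An absent page that is requested during `s` has to be loaded during `s`. The bound `B` is
assumed for every cache since the one left after `s` is unknown. -/
lemma add_le_loadCost_runFrom_append {B : ℝ} {q : Fin n} (s t past : List (Fin n))
    (C : Finset (Fin n)) (hq : q ∈ s) (hC : q ∉ C)
    (hB : ∀ C, B ≤ loadCost w C (A.runFrom ℓ w (past ++ s) t)) :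
    w q + B ≤ loadCost w C (A.runFrom ℓ w past (s ++ t)) := by
  induction s generalizing past C with
  | nil => simp at hq
  | cons x s ih =>
    simp only [List.cons_append, DetAlg.runFrom, loadCost]
    set C' := A.next w past x (lookahead ℓ (s ++ t)) with hC'
    by_cases h : q ∈ C'
    · refine add_le_add (single_le_sum (f := w) (fun p _ => (hw p).le)
        (mem_sdiff.2 ⟨h, hC⟩)) ?_
      exact le_loadCost_runFrom_append A ℓ hw s t _ _ (by simpa using hB)
    · have hx : q ≠ x := by
        rintro rfl
        exact h (A.mem_next _ _ _ _)
      exact le_add_of_nonneg_of_le (sum_nonneg fun p _ => (hw p).le)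
        (ih (past ++ [x]) _ (by simpa [hx] using hq) h (by simpa using hB))

end Run

/-! ### The request sequences of the adversary -/

/-- Each of the given pages is requested after a block of requests to `a` and the pages in `L`. -/
def requests (a : Fin n) (L : List (Fin n)) : List (Fin n) → List (Fin n)
  | [] => []
  | p :: ps => a :: (L ++ [p]) ++ requests a L ps

/-- The sum of the amounts `M past p` over all blocks of `requests a L ps`. -/
def gain (a : Fin n) (L : List (Fin n)) (M : List (Fin n) → Fin n → ℝ) :
    List (Fin n) → List (Fin n) → ℝ
  | _, [] => 0
  | past, p :: ps => M past p + gain a L M (past ++ a :: (L ++ [p])) ps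

/-- The number of phases that end in a sequence of pages. A phase ends when all pages of `S` have
been seen in it; in the current phase the pages of `U` are still to come. -/
def phases (S : Finset (Fin n)) : Finset (Fin n) → List (Fin n) → ℕ
  | _, [] => 0
  | U, p :: ps => if U.erase p = ∅ then phases S S ps + 1 else phases S (U.erase p) ps

/-- Weight `1` on `E` and `ε` elsewhere. -/
def twoWeights (E : Finset (Fin n)) (ε : ℝ) (p : Fin n) : ℝ := if p ∈ E then 1 else ε

lemma twoWeights_pos {E : Finset (Fin n)} {ε : ℝ} (hε : 0 < ε) (p : Fin n) :
    0 < twoWeights E ε p := by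
  unfold twoWeights
  split_ifs <;> positivity

/-! ### Upper bound for the optimum -/

section Opt

variable {E : Finset (Fin n)} {ε : ℝ} (hε : 0 < ε)
include hε

/-- Only `x` can be evicted, and only if it is a light page. -/
lemma sum_insert_sdiff_le {q x : Fin n} (hx : x ≠ q) :
    ∑ p ∈ insert x (E.erase q) \ E.erase q, twoWeights E ε p ≤ ε := by
  by_cases h : x ∈ E
  · rw [insert_eq_of_mem (mem_erase.2 ⟨hx, h⟩)]
    simpa using hε.le
  · rw [insert_sdiff_of_notMem _ (by simp [h])]
    simp [twoWeights, h]

lemma scheduleCost_map_append_le {q : Fin n} {B : ℝ} {D : List (Finset (Fin n))}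
    (hD : ∀ C, scheduleCost (twoWeights E ε) C D
      ≤ ∑ p ∈ C \ E.erase q, twoWeights E ε p + B)
    (l : List (Fin n)) (hl : q ∉ l) (C : Finset (Fin n)) :
    scheduleCost (twoWeights E ε) C (l.map (fun x => insert x (E.erase q)) ++ D)
      ≤ ∑ p ∈ C \ E.erase q, twoWeights E ε p + (ε * l.length + B) := by
  induction l generalizing C with
  | nil => simpa using hD C
  | cons x l ih =>
    simp only [List.mem_cons, not_or] at hl
    have h1 := ih hl.2 (insert x (E.erase q))
    have h2 := sum_insert_sdiff_le (E := E) hε (Ne.symm hl.1)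
    have h3 : ∑ p ∈ C \ insert x (E.erase q), twoWeights E ε p
        ≤ ∑ p ∈ C \ E.erase q, twoWeights E ε p :=
      sum_le_sum_of_subset_of_nonneg (sdiff_subset_sdiff le_rfl (subset_insert _ _))
        fun p _ _ => (twoWeights_pos hε p).le
    simp only [List.map_cons, List.cons_append, scheduleCost, List.length_cons, Nat.cast_add,
      Nat.cast_one]
    linarith

/-- The left-out page `q` is found by backward induction: it stays the same within a phase and is
replaced only when its own request ends the phase. A block has `L.length + 2` requests, each costing
at most `ε` apart from these replacements. -/
lemma exists_schedule {S : Finset (Fin n)} (hSE : S ⊆ E) (hE : E.card ≤ k) (hS : S.Nonempty)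
    {a : Fin n} (ha : a ∉ E) {L : List (Fin n)} (hL : ∀ p ∈ L, p ∉ S) (ps : List (Fin n))
    (U : Finset (Fin n)) (hUS : U ⊆ S) (hU : U.Nonempty) :
    ∃ q ∈ U, ∃ Cs, IsSchedule k (requests a L ps) Cs ∧
      ∀ C, scheduleCost (twoWeights E ε) C Cs ≤ ∑ p ∈ C \ E.erase q, twoWeights E ε p
        + (phases S U ps + ε * (L.length + 2) * ps.length) := by
  induction ps generalizing U with
  | nil =>
    obtain ⟨q, hq⟩ := hU
    refine ⟨q, hq, [], List.Forall₂.nil, fun C => ?_⟩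
    simpa [scheduleCost, phases] using sum_nonneg fun p _ => (twoWeights_pos hε p).le
  | cons p ps ih =>
    -- The subtracted sum reserves room for the evictions that turn the cache after `p` into the one
    -- for the later blocks.
    have key : ∃ q ∈ U, ∃ q' Cs, IsSchedule k (requests a L ps) Cs ∧
        (∀ C, scheduleCost (twoWeights E ε) C Cs ≤ ∑ p ∈ C \ E.erase q', twoWeights E ε p
          + ((phases S U (p :: ps) : ℝ) + ε * (L.length + 2) * ps.length + ε -
            ∑ x ∈ insert p (E.erase q) \ E.erase q', twoWeights E ε x)) := by
      by_cases h : U.erase p = ∅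
      · obtain ⟨q', hq', Cs, hCs, hcost⟩ := ih S le_rfl hS
        obtain ⟨q, hq⟩ := hU
        have hqp : q = p := by
          by_contra hne
          simpa [h] using mem_erase.2 ⟨hne, hq⟩
        subst hqp
        refine ⟨q, hq, q', Cs, hCs, fun C => (hcost C).trans ?_⟩
        -- After the request to `q` the cache is exactly `E`, so only `q'`, of weight 1, has to go.
        have h1 : ∑ x ∈ insert q (E.erase q) \ E.erase q', twoWeights E ε x ≤ 1 := by
          rw [insert_erase (hSE (hUS hq)), sdiff_erase (hSE hq')]
          simp [twoWeights, hSE hq']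
        simp only [phases, h, if_true, Nat.cast_add, Nat.cast_one]
        linarith
      · obtain ⟨q, hq, Cs, hCs, hcost⟩ :=
          ih (U.erase p) ((erase_subset _ _).trans hUS) (nonempty_iff_ne_empty.2 h)
        refine ⟨q, mem_of_mem_erase hq, q, Cs, hCs, fun C => (hcost C).trans ?_⟩
        have h1 := sum_insert_sdiff_le (E := E) hε (ne_of_mem_erase hq).symm
        simp only [phases, h, if_false]
        linarith
    obtain ⟨q, hq, q', Cs, hCs, hcost⟩ := key
    have hqS := hUS hq
    refine ⟨q, hq, (a :: L).map (fun x => insert x (E.erase q)) ++ insert p (E.erase q) :: Cs,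
      ?_, fun C => ?_⟩
    · have hcard (x : Fin n) : (insert x (E.erase q)).card ≤ k := by
        refine (card_insert_le _ _).trans ?_
        rw [card_erase_add_one (hSE hqS)]
        exact hE
      have hmap (l : List (Fin n)) : IsSchedule k l (l.map fun x => insert x (E.erase q)) := by
        refine List.forall₂_map_right_iff.2 (List.forall₂_same.2 fun x _ => ?_)
        exact ⟨mem_insert_self _ _, hcard x⟩
      have : requests a L (p :: ps) = (a :: L) ++ p :: requests a L ps := by simp [requests]
      rw [this]
      exact List.rel_append (hmap _) (List.Forall₂.cons ⟨mem_insert_self _ _, hcard p⟩ hCs)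
    · have hql : q ∉ a :: L := by
        simp only [List.mem_cons, not_or]
        exact ⟨fun h => ha (h ▸ hSE hqS), fun h => hL q h hqS⟩
      refine (scheduleCost_map_append_le hε
        (B := (phases S U (p :: ps) : ℝ) + ε * (L.length + 2) * ps.length + ε)
        (fun C => ?_) (a :: L) hql C).trans ?_
      · have h3 : ∑ x ∈ C \ insert p (E.erase q), twoWeights E ε x
            ≤ ∑ x ∈ C \ E.erase q, twoWeights E ε x :=
          sum_le_sum_of_subset_of_nonneg (sdiff_subset_sdiff le_rfl (subset_insert _ _))
            fun p _ _ => (twoWeights_pos hε p).le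
        have h4 := hcost (insert p (E.erase q))
        simp only [scheduleCost]
        linarith
      · simp only [List.length_cons, Nat.cast_add, Nat.cast_one]
        linarith

lemma opt_requests_le {S : Finset (Fin n)} (hSE : S ⊆ E) (hE : E.card ≤ k) (hS : S.Nonempty)
    {a : Fin n} (ha : a ∉ E) {L : List (Fin n)} (hL : ∀ p ∈ L, p ∉ S) (ps : List (Fin n)) :
    opt k (twoWeights E ε) (requests a L ps)
      ≤ phases S S ps + ε * (L.length + 2) * ps.length := by
  obtain ⟨q, -, Cs, hCs, hcost⟩ := exists_schedule hε hSE hE hS ha hL ps S le_rfl hS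
  exact (opt_le (twoWeights_pos hε) hCs).trans (by simpa using hcost ∅)

end Opt

/-! ### Lower bound for an algorithm -/

/-- The cache of `A` at the start of a block. -/
def blockCache (A : DetAlg n k) (ℓ : ℕ) (w : Fin n → ℝ) (a : Fin n) (L past : List (Fin n)) :
    Finset (Fin n) :=
  A.next w past a (lookahead ℓ L)

/-- Whether a cache `X` lacks `p` or a page of `H`. -/
noncomputable def missing (H X : Finset (Fin n)) (p : Fin n) : ℝ :=
  if insert p H ⊆ X then 0 else 1

lemma missing_nonneg (H X : Finset (Fin n)) (p : Fin n) : 0 ≤ missing H X p := by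
  unfold missing
  split_ifs <;> norm_num

lemma exists_missing_eq_one {S E : Finset (Fin n)} (hS : S.Nonempty) (hE : k ≤ E.card)
    {a : Fin n} (ha : a ∉ E) {X : Finset (Fin n)} (haX : a ∈ X) (hX : X.card ≤ k) :
    ∃ p ∈ S, missing (E \ S) X p = 1 := by
  have h : ¬ E ⊆ X := fun h => by
    have := card_le_card (insert_subset haX h)
    rw [card_insert_of_notMem ha] at this
    omega
  obtain ⟨q, hqE, hqX⟩ := not_subset.1 h
  by_cases hq : q ∈ S
  · exact ⟨q, hq, if_neg fun h => hqX (h (mem_insert_self _ _))⟩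
  · obtain ⟨p, hp⟩ := hS
    exact ⟨p, hp, if_neg fun h => hqX (h (mem_insert_of_mem (mem_sdiff.2 ⟨hqE, hq⟩)))⟩

lemma gain_le_loadCost (A : DetAlg n k) {ℓ : ℕ} {w : Fin n → ℝ} (hw : ∀ p, 0 < w p)
    {S E : Finset (Fin n)} (hSE : S ⊆ E) (hwE : ∀ p ∈ E, w p = 1) {a : Fin n}
    {L : List (Fin n)} (hL : ∀ p, p ∈ L ↔ p ∉ S) (hℓ : ℓ ≤ L.toFinset.card)
    (ps past : List (Fin n)) (hps : ∀ p ∈ ps, p ∈ S) (C : Finset (Fin n)) :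
    gain a L (fun past => missing (E \ S) (blockCache A ℓ w a L past)) past ps
      ≤ loadCost w C (A.runFrom ℓ w past (requests a L ps)) := by
  induction ps generalizing past C with
  | nil => exact le_rfl
  | cons p ps ih =>
    have hB (C : Finset (Fin n)) := ih (past ++ a :: (L ++ [p]))
      (fun x hx => hps x (List.mem_cons_of_mem _ hx)) C
    simp only [requests, List.cons_append, DetAlg.runFrom, loadCost, gain]
    refine le_add_of_nonneg_of_le (sum_nonneg fun p _ => (hw p).le) ?_
    -- The lookahead ends within `L`, so this cache does not depend on `p` or on later blocks.
    have hX : A.next w past a (lookahead ℓ (L ++ [p] ++ requests a L ps))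
        = blockCache A ℓ w a L past := by
      rw [List.append_assoc, lookahead_append _ _ hℓ, blockCache]
    rw [hX]
    have hB' (C : Finset (Fin n)) :
        gain a L (fun past => missing (E \ S) (blockCache A ℓ w a L past))
          (past ++ a :: (L ++ [p])) ps
        ≤ loadCost w C (A.runFrom ℓ w (past ++ [a] ++ (L ++ [p])) (requests a L ps)) := by
      simpa using hB C
    by_cases h : insert p (E \ S) ⊆ blockCache A ℓ w a L past
    · rw [missing, if_pos h, zero_add]
      exact le_loadCost_runFrom_append A ℓ hw _ _ _ _ hB'
    · rw [missing, if_neg h]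
      obtain ⟨q, hq, hqX⟩ := not_subset.1 h
      have hqE : q ∈ E ∧ q ∈ L ++ [p] := by
        rcases mem_insert.1 hq with rfl | hq
        · exact ⟨hSE (hps _ List.mem_cons_self), by simp⟩
        · rw [mem_sdiff] at hq
          exact ⟨hq.1, by simp [(hL q).2 hq.2]⟩
      rw [← hwE q hqE.1]
      exact add_le_loadCost_runFrom_append A ℓ hw _ _ _ _ hqE.2 hqX hB'

lemma gain_le_cost (A : DetAlg n k) {ℓ : ℕ} {w : Fin n → ℝ} (hw : ∀ p, 0 < w p)
    {S E : Finset (Fin n)} (hSE : S ⊆ E) (hwE : ∀ p ∈ E, w p = 1) {a : Fin n}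
    {L : List (Fin n)} (hL : ∀ p, p ∈ L ↔ p ∉ S) (hℓ : ℓ ≤ L.toFinset.card)
    (ps : List (Fin n)) (hps : ∀ p ∈ ps, p ∈ S) :
    gain a L (fun past => missing (E \ S) (blockCache A ℓ w a L past)) [] ps
      ≤ A.cost ℓ w (requests a L ps) + ∑ p, w p := by
  refine (gain_le_loadCost A hw hSE hwE hL hℓ ps [] hps ∅).trans ?_
  simpa [DetAlg.cost] using loadCost_le hw ∅ (A.runFrom ℓ w [] (requests a L ps))

/-! ### The adversary -/

/-- If in every phase the adversary can choose a page for which the gain exceeds `c` times the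
growth of the potential `h` by `δ`, then the total gain exceeds `c` times the number of phases by
`δ` per request. -/
lemma exists_le_gain {S : Finset (Fin n)} (hS : S.Nonempty) (a : Fin n) (L : List (Fin n))
    (M : List (Fin n) → Fin n → ℝ) {c δ : ℝ} (hc : 0 ≤ c) {h : ℕ → ℝ} (h0 : h 0 = 1)
    (hs : h S.card = 0) (hh : ∀ u ≤ S.card, 0 ≤ h u)
    (hM : ∀ past U, U ⊆ S → U.Nonempty →
      ∃ p ∈ S, δ + c * (h (U.erase p).card - h U.card) ≤ M past p)
    (T : ℕ) (past : List (Fin n)) (U : Finset (Fin n)) (hUS : U ⊆ S) (hU : U.Nonempty) :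
    ∃ ps : List (Fin n), ps.length = T ∧ (∀ p ∈ ps, p ∈ S) ∧
      δ * T + c * (phases S U ps - h U.card) ≤ gain a L M past ps := by
  induction T generalizing past U with
  | zero =>
    refine ⟨[], rfl, by simp, ?_⟩
    simpa [phases, gain] using mul_nonneg hc (hh _ (card_le_card hUS))
  | succ T ih =>
    obtain ⟨p, hp, hpM⟩ := hM past U hUS hU
    have key : ∃ ps : List (Fin n), ps.length = T ∧ (∀ p ∈ ps, p ∈ S) ∧
        δ * T + c * (phases S U (p :: ps) - h (U.erase p).card)
          ≤ gain a L M (past ++ a :: (L ++ [p])) ps := by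
      -- At the end of a phase the potential falls from `h 0 = 1` to `h S.card = 0`, which pays for
      -- the phase just counted.
      by_cases hUp : U.erase p = ∅
      · obtain ⟨ps, h1, h2, h3⟩ := ih (past ++ a :: (L ++ [p])) S le_rfl hS
        refine ⟨ps, h1, h2, le_trans (le_of_eq ?_) h3⟩
        simp [phases, hUp, hs, h0]
      · obtain ⟨ps, h1, h2, h3⟩ := ih (past ++ a :: (L ++ [p])) (U.erase p)
          ((erase_subset _ _).trans hUS) (nonempty_iff_ne_empty.2 hUp)
        refine ⟨ps, h1, h2, le_trans (le_of_eq ?_) h3⟩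
        simp [phases, hUp]
    obtain ⟨ps, h1, h2, h3⟩ := key
    refine ⟨p :: ps, by simp [h1], by simpa [hp] using h2, ?_⟩
    simp only [gain, Nat.cast_add, Nat.cast_one]
    linarith

/-- A cost function `cost` that is at least the gains `M` of the adversary, up to a constant, is not
`c`-competitive. -/
lemma not_competitive_of_gain {S E : Finset (Fin n)} (hSE : S ⊆ E) (hE : E.card ≤ k)
    (hS : S.Nonempty) {a : Fin n} (ha : a ∉ E) {L : List (Fin n)} (hL : ∀ p, p ∈ L ↔ p ∉ S)
    {c δ : ℝ} (hc : 0 ≤ c) (hδ : 0 < δ) {h : ℕ → ℝ} (h0 : h 0 = 1)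
    (hs : h S.card = 0) (hh : ∀ u ≤ S.card, 0 ≤ h u)
    (cost : (Fin n → ℝ) → List (Fin n) → ℝ) (M : (Fin n → ℝ) → List (Fin n) → Fin n → ℝ)
    (hcost : ∀ w : Fin n → ℝ, (∀ p, 0 < w p) → (∀ p ∈ E, w p = 1) → ∀ ps, (∀ p ∈ ps, p ∈ S) →
      gain a L (M w) [] ps ≤ cost w (requests a L ps) + ∑ p, w p)
    (hM : ∀ w past U, U ⊆ S → U.Nonempty →
      ∃ p ∈ S, δ + c * (h (U.erase p).card - h U.card) ≤ M w past p) :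
    ¬ ∀ w : Fin n → ℝ, (∀ p, 0 < w p) →
      ∃ b : ℝ, ∀ σ : List (Fin n), cost w σ ≤ c * opt k w σ + b := by
  intro hcomp
  set m : ℝ := L.length + 2 with hm
  have hm0 : 0 < m := by positivity
  -- Light pages use up at most half of the surplus `δ` per block; `c + 1` avoids division by zero.
  set ε : ℝ := δ / (2 * (c + 1) * m) with hεdef
  have hε : 0 < ε := by positivity
  have hεm : c * (ε * m) ≤ δ / 2 := by
    have h1 : ε * m = δ / 2 / (c + 1) := by
      rw [hεdef]
      field_simp
    rw [h1, mul_div_assoc', div_le_iff₀ (by positivity)]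
    nlinarith
  obtain ⟨b, hb⟩ := hcomp (twoWeights E ε) (twoWeights_pos hε)
  set W := ∑ p, twoWeights E ε p with hW
  obtain ⟨T, hT⟩ := exists_nat_gt ((W + b) / (δ / 2))
  rw [div_lt_iff₀ (by positivity)] at hT
  obtain ⟨ps, hlen, hps, hgain⟩ :=
    exists_le_gain hS a L (M (twoWeights E ε)) hc h0 hs hh (hM _) T [] S le_rfl hS
  have h1 := hcost (twoWeights E ε) (twoWeights_pos hε) (fun p hp => if_pos hp) ps hps
  have h2 := hb (requests a L ps)
  have h3 := mul_le_mul_of_nonneg_left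
    (opt_requests_le (k := k) hε hSE hE hS ha (fun p hp => (hL p).1 hp) ps) hc
  have h4 := mul_le_mul_of_nonneg_right hεm (Nat.cast_nonneg (α := ℝ) T)
  rw [hs] at hgain
  rw [hlen, ← hm] at h3
  linarith

lemma exists_pages {s k n ℓ : ℕ} (hsk : s ≤ k) (hkn : k < n) (hℓ : ℓ ≤ n - s) :
    ∃ (S E : Finset (Fin n)) (a : Fin n) (L : List (Fin n)), S ⊆ E ∧ S.card = s ∧ E.card = k ∧
      a ∉ E ∧ (∀ p, p ∈ L ↔ p ∉ S) ∧ ℓ ≤ L.toFinset.card := by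
  obtain ⟨E, -, hE⟩ := exists_subset_card_eq (s := (univ : Finset (Fin n))) (n := k)
    (by simpa using hkn.le)
  obtain ⟨S, hSE, hS⟩ := exists_subset_card_eq (hE ▸ hsk)
  obtain ⟨a, ha⟩ : ∃ a, a ∉ E := by
    by_contra! h
    rw [eq_univ_iff_forall.2 h, card_univ, Fintype.card_fin] at hE
    omega
  refine ⟨S, E, a, Sᶜ.toList, hSE, hS, hE, ha, by simp, ?_⟩
  rw [toList_toFinset, card_compl, Fintype.card_fin, hS]
  exact hℓ

/-! ### Deterministic algorithms -/

theorem DetAlg.IsCompetitive.le {s ℓ : ℕ} (hs : 1 ≤ s) (hsk : s ≤ k) (hkn : k < n)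
    (hℓ : ℓ ≤ n - s) {A : DetAlg n k} {c : ℝ} (hA : A.IsCompetitive ℓ c) : (s : ℝ) ≤ c := by
  have hs0 : (0 : ℝ) < s := by exact_mod_cast hs
  -- The potential argument needs a nonnegative ratio.
  suffices h : (s : ℝ) ≤ max c 0 from (le_max_iff.1 h).resolve_right hs0.not_ge
  by_contra! hcs
  obtain ⟨S, E, a, L, hSE, hS, hE, ha, hL, hℓL⟩ := exists_pages hsk hkn hℓ
  have hSne : S.Nonempty := card_pos.1 (by omega)
  refine not_competitive_of_gain (k := k) (δ := 1 - max c 0 / s) (h := fun u => 1 - u / s)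
    hSE hE.le hSne ha hL (le_max_right c 0) ?_ (by simp) ?_ ?_ (A.cost ℓ)
    (fun w past => missing (E \ S) (blockCache A ℓ w a L past)) ?_ ?_ ?_
  · rw [sub_pos, div_lt_one hs0]
    exact hcs
  · simp [hS, hs0.ne']
  · intro u hu
    rw [sub_nonneg, div_le_one hs0]
    exact_mod_cast hS ▸ hu
  · exact fun w hw hwE ps hps => gain_le_cost A hw hSE hwE hL hℓL ps hps
  · intro w past U hUS hU
    obtain ⟨p, hp, hpX⟩ := exists_missing_eq_one hSne hE.ge ha
      (A.mem_next w past a (lookahead ℓ L)) (A.card_next w past a (lookahead ℓ L))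
    refine ⟨p, hp, ?_⟩
    rw [blockCache, hpX]
    -- One request removes at most one page from `U`, so the potential grows by at most `1 / s`.
    have h1 : (U.card : ℝ) ≤ (U.erase p).card + 1 := by
      exact_mod_cast Nat.le_succ_of_pred_le (pred_card_le_card_erase (s := U) (a := p))
    have h2 : (1 - ((U.erase p).card : ℝ) / s) - (1 - (U.card : ℝ) / s) ≤ 1 / s := by
      rw [sub_sub_sub_cancel_left, ← sub_div]
      gcongr
      linarith
    have h3 := mul_le_mul_of_nonneg_left h2 (le_max_right c 0)
    rw [mul_one_div] at h3
    linarith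
  · intro w hw
    obtain ⟨b, hb⟩ := hA w hw
    refine ⟨b, fun σ => (hb σ).trans ?_⟩
    have := mul_le_mul_of_nonneg_right (le_max_left c 0) (opt_nonneg (k := k) hw σ)
    linarith

/-! ### Randomized algorithms -/

section Rand

open MeasureTheory

variable (A : RandAlg.{u} n k)

lemma RandAlg.integrable_comp_next (w : Fin n → ℝ) (past : List (Fin n)) (p : Fin n)
    (look : List (Fin n)) (f : Finset (Fin n) → ℝ) :
    Integrable (fun ω => f ((A.alg ω).next w past p look)) A.μ := by
  let _ : MeasurableSpace (Finset (Fin n)) := ⊤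
  have hF : Measurable fun ω => (A.alg ω).next w past p look :=
    measurable_to_countable' fun C => A.measurableSet_next w past p look C
  have hf : Measurable f := measurable_from_top
  refine Integrable.of_bound (hf.comp hF).aestronglyMeasurable (∑ C, ‖f C‖)
    (Filter.Eventually.of_forall fun ω => ?_)
  exact single_le_sum (f := fun C => ‖f C‖) (fun C _ => norm_nonneg _) (mem_univ _)

lemma RandAlg.integrable_scheduleCost (ℓ : ℕ) (w : Fin n → ℝ) (σ past : List (Fin n))
    (F : A.Ω → Finset (Fin n)) (hF : ∀ C, MeasurableSet {ω | F ω = C}) :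
    Integrable (fun ω => scheduleCost w (F ω) ((A.alg ω).runFrom ℓ w past σ)) A.μ := by
  induction σ generalizing past F with
  | nil => simp [DetAlg.runFrom, scheduleCost]
  | cons p σ ih =>
    refine Integrable.add ?_ (ih (past ++ [p]) _ (A.measurableSet_next w past p (lookahead ℓ σ)))
    let _ : MeasurableSpace (Finset (Fin n)) := ⊤
    have : DiscreteMeasurableSpace (Finset (Fin n)) := ⟨fun _ => trivial⟩
    have hF' : Measurable F := measurable_to_countable' hF
    have hG : Measurable fun ω => (A.alg ω).next w past p (lookahead ℓ σ) :=
      measurable_to_countable' fun C => A.measurableSet_next w past p _ C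
    let f : Finset (Fin n) × Finset (Fin n) → ℝ := fun C => ∑ p ∈ C.1 \ C.2, w p
    have hf : Measurable f := measurable_of_countable f
    refine Integrable.of_bound (hf.comp (hF'.prodMk hG)).aestronglyMeasurable (∑ C, ‖f C‖)
      (Filter.Eventually.of_forall fun ω => ?_)
    exact single_le_sum (f := fun C => ‖f C‖) (fun C _ => norm_nonneg _)
      (mem_univ (F ω, (A.alg ω).next w past p (lookahead ℓ σ)))

lemma RandAlg.integrable_cost (ℓ : ℕ) (w : Fin n → ℝ) (σ : List (Fin n)) :
    Integrable (fun ω => (A.alg ω).cost ℓ w σ) A.μ :=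
  A.integrable_scheduleCost ℓ w σ [] (fun _ => ∅) fun _ => MeasurableSet.const _

/-- The gain is a sum over fixed pasts, so the adversary can play against expected amounts. -/
lemma integrable_gain_and_integral_gain {Ω : Type*} [MeasurableSpace Ω] {μ : Measure Ω}
    (a : Fin n) (L : List (Fin n)) (M : Ω → List (Fin n) → Fin n → ℝ)
    (hM : ∀ past p, Integrable (fun ω => M ω past p) μ) (past ps : List (Fin n)) :
    Integrable (fun ω => gain a L (M ω) past ps) μ ∧
      ∫ ω, gain a L (M ω) past ps ∂μ = gain a L (fun past p => ∫ ω, M ω past p ∂μ) past ps := by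
  induction ps generalizing past with
  | nil => simp [gain]
  | cons p ps ih =>
    obtain ⟨h1, h2⟩ := ih (past ++ a :: (L ++ [p]))
    refine ⟨(hM past p).add h1, ?_⟩
    simp only [gain]
    rw [integral_add (hM past p) h1, h2]

/-- Each page of `U` contributes `1 / U.card`, the others nothing. -/
lemma sum_harmonic_erase {S U : Finset (Fin n)} (hUS : U ⊆ S) (hU : U.Nonempty) :
    ∑ p ∈ S, ((harmonic U.card : ℝ) - harmonic (U.erase p).card) = 1 := by
  obtain ⟨u, hu⟩ : ∃ u, U.card = u + 1 := ⟨U.card - 1, by have := card_pos.2 hU; omega⟩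
  rw [← sum_subset hUS fun p _ hp => by rw [erase_eq_of_notMem hp, sub_self]]
  rw [sum_congr rfl fun p hp => by
    rw [card_erase_of_mem hp, hu, Nat.add_sub_cancel, harmonic_succ]]
  rw [sum_const, hu, nsmul_eq_mul]
  push_cast
  field_simp
  ring

theorem RandAlg.IsCompetitive.harmonic_le {s ℓ : ℕ} (hs : 1 ≤ s) (hsk : s ≤ k) (hkn : k < n)
    (hℓ : ℓ ≤ n - s) {A : RandAlg.{u} n k} {c : ℝ} (hA : A.IsCompetitive ℓ c) :
    (harmonic s : ℝ) ≤ c := by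
  have hs0 : (0 : ℝ) < s := by exact_mod_cast hs
  have hH : (0 : ℝ) < harmonic s := by exact_mod_cast harmonic_pos (by omega)
  suffices h : (harmonic s : ℝ) ≤ max c 0 from (le_max_iff.1 h).resolve_right hH.not_ge
  by_contra! hcs
  obtain ⟨S, E, a, L, hSE, hS, hE, ha, hL, hℓL⟩ := exists_pages hsk hkn hℓ
  have hSne : S.Nonempty := card_pos.1 (by omega)
  have hint (w : Fin n → ℝ) (past : List (Fin n)) (p : Fin n) :
      Integrable (fun ω => missing (E \ S) (blockCache (A.alg ω) ℓ w a L past) p) A.μ :=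
    A.integrable_comp_next w past a (lookahead ℓ L) fun X => missing (E \ S) X p
  -- This `δ` makes the required gains sum to exactly 1 over `S`, while the expected misses sum to
  -- at least 1; so some page works.
  refine not_competitive_of_gain (k := k) (δ := (1 - max c 0 / harmonic s) / s)
    (h := fun u => 1 - harmonic u / harmonic s)
    hSE hE.le hSne ha hL (le_max_right c 0) ?_ (by simp) ?_ ?_ (A.expectedCost ℓ)
    (fun w past p => ∫ ω, missing (E \ S) (blockCache (A.alg ω) ℓ w a L past) p ∂A.μ) ?_ ?_ ?_
  · refine div_pos ?_ hs0
    rw [sub_pos, div_lt_one hH]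
    exact hcs
  · simp [hS, hH.ne']
  · intro u hu
    rw [sub_nonneg, div_le_one hH]
    rw [hS] at hu
    have : harmonic u ≤ harmonic s :=
      sum_le_sum_of_subset_of_nonneg (range_mono hu) fun i _ _ => by positivity
    exact_mod_cast this
  · intro w hw hwE ps hps
    obtain ⟨h1, h2⟩ := integrable_gain_and_integral_gain a L
      (fun ω past => missing (E \ S) (blockCache (A.alg ω) ℓ w a L past)) (hint w) [] ps
    rw [← h2, RandAlg.expectedCost]
    refine (integral_mono h1 ((A.integrable_cost ℓ w _).add (integrable_const (∑ p, w p)))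
      fun ω => gain_le_cost (A.alg ω) hw hSE hwE hL hℓL ps hps).trans (le_of_eq ?_)
    simp only [Pi.add_apply]
    rw [integral_add (A.integrable_cost ℓ w _) (integrable_const _)]
    simp
  · intro w past U hUS hU
    refine exists_le_of_sum_le hSne ?_
    have h1 : (1 : ℝ) ≤
        ∑ p ∈ S, ∫ ω, missing (E \ S) (blockCache (A.alg ω) ℓ w a L past) p ∂A.μ := by
      rw [← integral_finsetSum _ fun p _ => hint w past p]
      have : (1 : ℝ) = ∫ _, 1 ∂A.μ := by simp
      rw [this]
      refine integral_mono (integrable_const _) (integrable_finsetSum _ fun p _ => hint w past p)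
        fun ω => ?_
      obtain ⟨p, hp, hpX⟩ := exists_missing_eq_one hSne hE.ge ha
        ((A.alg ω).mem_next w past a (lookahead ℓ L)) ((A.alg ω).card_next w past a (lookahead ℓ L))
      simp only
      rw [← hpX]
      exact single_le_sum (f := missing (E \ S) (blockCache (A.alg ω) ℓ w a L past))
        (fun p _ => missing_nonneg _ _ _) hp
    refine le_trans (le_of_eq ?_) h1
    rw [sum_add_distrib, ← mul_sum, sum_const, hS, nsmul_eq_mul, mul_div_cancel₀ _ hs0.ne']
    have h2 : ∑ p ∈ S, ((1 - (harmonic (U.erase p).card : ℝ) / harmonic s)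
        - (1 - (harmonic U.card : ℝ) / harmonic s)) = 1 / harmonic s := by
      rw [← sum_harmonic_erase hUS hU, sum_div]
      exact sum_congr rfl fun p _ => by ring
    rw [h2]
    ring
  · intro w hw
    obtain ⟨b, hb⟩ := hA w hw
    refine ⟨b, fun σ => (hb σ).trans ?_⟩
    have := mul_le_mul_of_nonneg_right (le_max_left c 0) (opt_nonneg (k := k) hw σ)
    linarith

theorem RandAlg.IsCompetitive.log_le {s ℓ : ℕ} (hs : 1 ≤ s) (hsk : s ≤ k) (hkn : k < n)
    (hℓ : ℓ ≤ n - s) {A : RandAlg.{u} n k} {c : ℝ} (hA : A.IsCompetitive ℓ c) :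
    Real.log s ≤ c := by
  refine le_trans ?_ (hA.harmonic_le hs hsk hkn hℓ)
  refine le_trans (Real.log_le_log (by exact_mod_cast hs) ?_) (log_add_one_le_harmonic s)
  push_cast
  linarith

end Rand

end WeightedPaging

theorem theorem2 :
    ∃ C : ℝ, 0 < C ∧ ∀ n k ℓ : ℕ, 1 ≤ k → k < n →
      (ℓ ≤ n - k →
        (∀ (A : WeightedPaging.DetAlg n k) (c : ℝ), A.IsCompetitive ℓ c → C * (k : ℝ) ≤ c) ∧
        (∀ (A : WeightedPaging.RandAlg.{u} n k) (c : ℝ),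
          A.IsCompetitive ℓ c → C * Real.log (k : ℝ) ≤ c)) ∧
      (n - k + 1 ≤ ℓ → ℓ ≤ n - 1 →
        (∀ (A : WeightedPaging.DetAlg n k) (c : ℝ),
          A.IsCompetitive ℓ c → C * ((n : ℝ) - (ℓ : ℝ)) ≤ c) ∧
        (∀ (A : WeightedPaging.RandAlg.{u} n k) (c : ℝ),
          A.IsCompetitive ℓ c → C * Real.log ((n : ℝ) - (ℓ : ℝ)) ≤ c)) := by
  refine ⟨1, one_pos, fun n k ℓ hk hkn => ⟨fun hℓ => ⟨fun A c hA => ?_, fun A c hA => ?_⟩,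
    fun hkℓ hℓ => ?_⟩⟩
  · rw [one_mul]
    exact hA.le hk le_rfl hkn hℓ
  · rw [one_mul]
    exact hA.log_le hk le_rfl hkn hℓ
  · rw [← Nat.cast_sub (by omega : ℓ ≤ n)]
    have hs : 1 ≤ n - ℓ := by omega
    have hsk : n - ℓ ≤ k := by omega
    have hℓs : ℓ ≤ n - (n - ℓ) := by omega
    refine ⟨fun A c hA => ?_, fun A c hA => ?_⟩
    · rw [one_mul]
      exact hA.le hs hsk hkn hℓs
    · rw [one_mul]
      exact hA.log_le hs hsk hkn hℓs
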